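/- Let $\mathbb F\in\{\mathbb R,\mathbb C\}$, let $p\in[1,\infty]$, and let $X$ be a Tychonoff space. Let $C_p(X)$ be the space $C(X)$ of continuous functions $X\to\mathbb F$ with the topology of pointwise convergence. Let $L(X)$ be the vector space over $\mathbb F$ with Hamel basis $X$, paired with $C(X)$ by $\langle\sum_i a_i x_i,f\rangle=\sum_i a_i f(x_i)$, and let $\mathcal T$ be a locally convex vector topology on $L(X)$ compatible with this duality, i.e. the $\mathcal T$-continuous linear functionals on $L(X)$ are exactly the functionals $\langle\cdot,f\rangle$ with $f\in C(X)$. Write $L_{\mathcal T}(X)=(L(X),\mathcal T)$. A sequence in a locally convex space $E$ is weakly $p$-summable if each $\chi\in E'$ maps it to a sequence in $\ell_p$ (in $c_0$ if $p=\infty$); a sequence in $E'$ is weak$^*$ $p$-summable if it is weakly $p$-summable in $(E',\sigma(E',E))$. The space $E$ is $p$-barrelled if every weak$^*$ $p$-summable sequence in $E'$ is equicontinuous. A non-empty set $A\subseteq E$ is $(p,q)$-limited if for every weak$^*$ $p$-summable sequence $(\chi_n)$ in $E'$ the sequence $\big(\sup_{a\in A}|\chi_n(a)|\big)_n$ is in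 $\ell_q$ (in $c_0$ if $q=\infty$). A set $A\subseteq X$ is functionally bounded if every $f\in C(X)$ is bounded on $A$. The space $E$ is quasi-complete if each closed bounded subset is complete, sequentially complete if each Cauchy sequence converges, and locally complete if the closed absolutely convex hull of each null sequence is compact. Then a subset of $C_p(X)$ is precompact if and only if it is bounded, and the following assertions are equivalent: 1. $C_p(X)$ is $p$-barrelled; 2. every non-empty precompact (equivalently, bounded) subset of $C_p(X)$ is $(p,\infty)$-limited; 3. $X$ has no infinite functionally bounded subsets; 4. each non-empty bounded subset of $C_p(X)$ is $(p,q)$-limited for some $q$ with $p\le q\le\infty$ ($q$ may depend on the set, or be chosen uniformly; the two versions are equivalent); 5. each non-empty bounded subset of $C_p(X)$ is $(p,q)$-limited for every $q$ with $p\le q\le\infty$; 6. $L_{\mathcal T}(X)$ is quasi-complete; 7. $L_{\mathcal T}(X)$ is sequentially complete; 8. $L_{\mathcal T}(X)$ is locally complete. -/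

import Mathlib

open Filter Topology Set
open scoped ENNReal Pointwise

/-- For a scalar sequence `a`: `a ∈ ℓ_p` if `p < ∞`, and `a ∈ c₀` if `p = ∞`. -/
def MemEllOrC0 {F : Type*} [NormedAddCommGroup F] (p : ℝ≥0∞) (a : ℕ → F) : Prop :=
  (p ≠ ∞ → Memℓp a p) ∧ (p = ∞ → Tendsto a atTop (𝓝 0))

section LocallyConvex

variable (𝕜 : Type*) [RCLike 𝕜] {E : Type*} [AddCommGroup E] [Module 𝕜 E]

/-- A sequence in a topological vector space is weakly `p`-summable if every continuous linear
functional maps it to a sequence in `ℓ_p` (in `c₀` if `p = ∞`). -/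
def WeaklyPSummable [TopologicalSpace E] (p : ℝ≥0∞) (x : ℕ → E) : Prop :=
  ∀ χ : E →L[𝕜] 𝕜, MemEllOrC0 p (fun n => χ (x n))

/-- A sequence of functionals is weak* `p`-summable if it is weakly `p`-summable in the dual
space endowed with the weak* topology. -/
def WeakStarPSummable [TopologicalSpace E] (p : ℝ≥0∞) (χ : ℕ → WeakDual 𝕜 E) : Prop :=
  WeaklyPSummable 𝕜 p χ

/-- A set of functionals is equicontinuous if it is contained in the polar of a neighbourhood
of zero. -/
def EquicontinuousFunctionals [TopologicalSpace E] (S : Set (WeakDual 𝕜 E)) : Prop :=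
  ∃ U ∈ 𝓝 (0 : E), ∀ χ ∈ S, ∀ x ∈ U, ‖χ x‖ ≤ 1

variable (E) in
/-- `E` is `p`-barrelled if every weak* `p`-summable sequence in its dual is equicontinuous. -/
def IsPBarrelled [TopologicalSpace E] (p : ℝ≥0∞) : Prop :=
  ∀ χ : ℕ → WeakDual 𝕜 E, WeakStarPSummable 𝕜 p χ → EquicontinuousFunctionals 𝕜 (range χ)

/-- A non-empty set `A` is `(p,q)`-limited if, for every weak* `p`-summable sequence `χ` in the
dual, the sequence of (finite) suprema `sup_{a ∈ A} |χ n a|` is in `ℓ_q` (in `c₀` if `q = ∞`). -/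
def IsPQLimited [TopologicalSpace E] (p q : ℝ≥0∞) (A : Set E) : Prop :=
  A.Nonempty ∧ ∀ χ : ℕ → WeakDual 𝕜 E, WeakStarPSummable 𝕜 p χ →
    (∀ n, BddAbove ((fun a => ‖χ n a‖) '' A)) ∧
      MemEllOrC0 q (fun n => sSup ((fun a => ‖χ n a‖) '' A))

/-- A set `A` is precompact if for every neighbourhood `U` of zero there is a finite set `F`
with `A ⊆ F + U`. -/
def IsPrecompactSet {E : Type*} [AddCommGroup E] [TopologicalSpace E] (A : Set E) : Prop :=
  ∀ U ∈ 𝓝 (0 : E), ∃ F : Set E, F.Finite ∧ A ⊆ F + U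

/-- Every Cauchy sequence converges. -/
def IsSequentiallyComplete (E : Type*) [UniformSpace E] : Prop :=
  ∀ x : ℕ → E, CauchySeq x → ∃ y, Tendsto x atTop (𝓝 y)

variable (E) in
open scoped ComplexOrder in
/-- The closed absolutely convex hull of every null sequence is compact. -/
def IsLocallyCompleteSpace [TopologicalSpace E] : Prop :=
  ∀ x : ℕ → E, Tendsto x atTop (𝓝 0) → IsCompact (closedAbsConvexHull 𝕜 (range x))

end LocallyConvex

section FunctionSpaces

variable (X 𝕜 : Type*) [TopologicalSpace X] [RCLike 𝕜]

/-- The space `C_p(X)`: all continuous functions `X → 𝕜`, as a subspace of `X → 𝕜` with the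
product topology, that is, with the topology of pointwise convergence. -/
abbrev Cp : Type _ := continuousSubmodule X 𝕜 𝕜

variable {X} in
/-- `A` is functionally bounded in `X` if every continuous scalar function on `X` is bounded
on `A`. -/
def FunctionallyBounded (A : Set X) : Prop :=
  ∀ f : C(X, 𝕜), Bornology.IsBounded (f '' A)

/-- The underlying vector space of the free locally convex space `L(X)`: the vector space with
Hamel basis `X` (the point `x` is `Finsupp.single x 1`, the Dirac measure at `x`). -/
abbrev FreeLSpace (X 𝕜 : Type*) [RCLike 𝕜] : Type _ := X →₀ 𝕜

variable {X 𝕜} in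
/-- The duality `⟨∑ aᵢ xᵢ, f⟩ = ∑ aᵢ f(xᵢ)` between `L(X)` and `C(X)`. -/
noncomputable def freePairing (μ : FreeLSpace X 𝕜) (f : C(X, 𝕜)) : 𝕜 :=
  μ.sum fun x a => a * f x

/-- A topology on `L(X)` is compatible with the duality `(L(X), C(X))` if the continuous linear
functionals are exactly the functionals `μ ↦ ⟨μ, f⟩` with `f` in `C(X)`. -/
def CompatibleWithDuality [TopologicalSpace (FreeLSpace X 𝕜)] : Prop :=
  ∀ φ : FreeLSpace X 𝕜 →ₗ[𝕜] 𝕜,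
    Continuous φ ↔ ∃ f : C(X, 𝕜), ∀ μ, φ μ = freePairing μ f

end FunctionSpaces

/-!
Everything is tied to the condition that `X` has no infinite functionally bounded subset.

Suppose it holds. Both the dual of `C_p(X)` and the space `L(X)` consist of finite combinations of
point evaluations. By a gliding hump argument (`exists_finset_bound_of_pointwise_bounded`), a set of
such combinations that is bounded at every `f ∈ C(X)` is supported on one finite set of points, with
bounded coefficients. So a weak* `p`-summable sequence in the dual of `C_p(X)` is a finite sum of
Dirac functionals with coefficient sequences in `ℓ_p` (or `c₀`), which gives that `C_p(X)` is
`p`-barrelled and that its bounded sets are `(p, q)`-limited for all `q ≥ p`. A bounded subset of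
`L(X)` lies in a compact absolutely convex set, which gives quasi-completeness and local
completeness in any compatible topology.

Conversely, let `A` be infinite and functionally bounded. There are points `x n ∈ A` and continuous
bumps `h n` with disjoint supports and `h n (x n) = 1` (`exists_seq_disjoint_bumps`). The
functionals `2⁻ⁿ δ_{x n}` are weak* `p`-summable but do not tend to zero uniformly on the bounded
set of the functions `2ⁿ h n`, so that this set is not `(p, ∞)`-limited; and a `p`-barrelled space
has all its precompact sets `(p, ∞)`-limited, since equicontinuous pointwise null sequences are
uniformly null on precompact sets. In `L(X)`, the Dirac measures at the points `x n` are weakly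
bounded, hence bounded for every continuous seminorm by Mackey's theorem. The partial sums of
`∑ 2⁻ᵏ δ_{x k}` are therefore Cauchy, and those of `∑ 2⁻ᵏ⁻¹ (2⁻ᵏ δ_{x k})` lie in the closed
absolutely convex hull of the null sequence `2⁻ᵏ δ_{x k}`. Neither has a cluster point, because a
cluster point would have to be non-zero on every `h n`, and an element of `L(X)` has finite support
(`not_mapClusterPt_sum_single`).
-/

/-! ### The pairing between `L(X)` and `C(X)` -/

section Pairing

variable {𝕜 : Type*} [RCLike 𝕜] {X : Type*} [TopologicalSpace X]

theorem freePairing_eq_linearCombination (μ : FreeLSpace X 𝕜) (f : C(X, 𝕜)) :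
    freePairing μ f = Finsupp.linearCombination 𝕜 f μ := by
  simp [freePairing, Finsupp.linearCombination_apply]

theorem freePairing_single (x : X) (a : 𝕜) (f : C(X, 𝕜)) :
    freePairing (Finsupp.single x a) f = a * f x := by
  simp [freePairing_eq_linearCombination]

theorem freePairing_eq_sum (μ : FreeLSpace X 𝕜) (f : C(X, 𝕜)) :
    freePairing μ f = ∑ x ∈ μ.support, μ x * f x := rfl

theorem freePairing_eq_sum_of_subset {μ : FreeLSpace X 𝕜} {F : Finset X} (h : μ.support ⊆ F)
    (f : C(X, 𝕜)) : freePairing μ f = ∑ x ∈ F, μ x * f x :=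
  Finsupp.sum_of_support_subset μ h _ (by simp)

/-- If `f` is `1` at `x` and vanishes at the other points of the support of `μ`, then pairing with
`f` reads off the coefficient of `μ` at `x`. -/
theorem freePairing_eq_apply {μ : FreeLSpace X 𝕜} {f : C(X, 𝕜)} {x : X} (hx : f x = 1)
    (h : ∀ y ∈ μ.support, y ≠ x → f y = 0) : freePairing μ f = μ x := by
  rw [freePairing_eq_sum, Finset.sum_eq_single x (fun y hy hyx => by rw [h y hy hyx, mul_zero])
    (fun hxs => by rw [Finsupp.notMem_support_iff.1 hxs, zero_mul]), hx, mul_one]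

end Pairing

/-! ### Bump functions on Tychonoff spaces -/

section Bump

variable (𝕜 : Type*) [RCLike 𝕜] {X : Type*} [TopologicalSpace X]

theorem exists_real_bump [CompletelyRegularSpace X] {x : X} {U : Set X} (hU : IsOpen U)
    (hx : x ∈ U) :
    ∃ f : C(X, ℝ), f x = 1 ∧ (∀ y ∉ U, f y = 0) ∧ ∀ y, 0 ≤ f y ∧ f y ≤ 1 := by
  obtain ⟨f, hf, hfx, hfU⟩ := CompletelyRegularSpace.completely_regular_isOpen x U hU hx
  refine ⟨⟨fun y => 1 - (f y : ℝ), by fun_prop⟩, by simp [hfx], fun y hy => ?_, fun y => ?_⟩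
  · have := hfU hy
    simp [this]
  · exact ⟨by simpa using (f y).2.2, by simpa using (f y).2.1⟩

theorem exists_bump [CompletelyRegularSpace X] {x : X} {U : Set X} (hU : IsOpen U) (hx : x ∈ U) :
    ∃ f : C(X, 𝕜), f x = 1 ∧ ∀ y ∉ U, f y = 0 := by
  obtain ⟨f, hfx, hfU, -⟩ := exists_real_bump hU hx
  exact ⟨⟨fun y => (f y : 𝕜), by fun_prop⟩, by simp [hfx], fun y hy => by simp [hfU y hy]⟩

/-- A bump at `x` that vanishes at the other points of a given finite set. -/
theorem exists_bump_finset [T35Space X] (F : Finset X) (x : X) :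
    ∃ f : C(X, 𝕜), f x = 1 ∧ ∀ y ∈ F, y ≠ x → f y = 0 := by
  obtain ⟨f, hfx, hf⟩ := exists_bump 𝕜 (x := x) (U := ((F : Set X) \ {x})ᶜ)
    (F.finite_toSet.subset sdiff_subset).isClosed.isOpen_compl (by simp)
  exact ⟨f, hfx, fun y hy hyx => hf y fun h => h ⟨hy, hyx⟩⟩

/-- Every infinite set of a Tychonoff space contains a sequence of points carried by continuous
bump functions with pairwise disjoint supports. The subspace `A` has pairwise disjoint
non-empty open sets, but these come from open sets of `X` that may meet outside `A`; the bumps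
`f n` they give are therefore combined into one function `G = ∑ 3⁻ⁿ f n`, whose values `3⁻ⁿ`
at the chosen points are isolated from each other. -/
theorem exists_seq_disjoint_bumps [T35Space X] {A : Set X} (hA : A.Infinite) :
    ∃ (x : ℕ → X) (h : ℕ → C(X, 𝕜)), (∀ n, x n ∈ A) ∧ (∀ n, h n (x n) = 1) ∧
      ∀ y m n, h m y ≠ 0 → h n y ≠ 0 → m = n := by
  have : Infinite A := hA.to_subtype
  obtain ⟨V, hVinf, hVo, hVd⟩ := exists_seq_infinite_isOpen_pairwise_disjoint A
  choose x hxV using fun n => (hVinf n).nonempty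
  choose W hWo hWV using fun n => isOpen_induced_iff.1 (hVo n)
  have hxW (m n : ℕ) : (x m : X) ∈ W n ↔ m = n := by
    have : (x m : X) ∈ W n ↔ x m ∈ V n := by rw [← hWV n]; rfl
    rw [this]
    refine ⟨fun hmn => ?_, fun hmn => hmn ▸ hxV m⟩
    by_contra hne
    exact Set.disjoint_left.1 (hVd hne) (hxV m) hmn
  choose f hfx hfW hf01 using fun n => exists_real_bump (hWo n) ((hxW n n).2 rfl)
  let G : X → ℝ := fun y => ∑' n, (1 / 3 : ℝ) ^ n * f n y
  have hG : Continuous G := by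
    refine continuous_tsum (u := fun n => (1 / 3 : ℝ) ^ n) (fun n => by fun_prop)
      (summable_geometric_of_lt_one (by norm_num) (by norm_num)) fun n y => ?_
    rw [Real.norm_of_nonneg (mul_nonneg (by positivity) (hf01 n y).1)]
    exact mul_le_of_le_one_right (by positivity) (hf01 n y).2
  have hGx (n : ℕ) : G (x n) = (1 / 3) ^ n := by
    refine (tsum_eq_single n fun m hm => ?_).trans (by rw [hfx, mul_one])
    rw [hfW m _ fun h => hm ((hxW n m).1 h).symm, mul_zero]
  let g : ℕ → X → ℝ := fun n y => max 0 (1 - 4 * 3 ^ n * |G y - (1 / 3) ^ n|)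
  have hg (n : ℕ) (y : X) (hy : g n y ≠ 0) : |3 ^ n * G y - 1| < 1 / 4 := by
    have h0 : 0 < 1 - 4 * 3 ^ n * |G y - (1 / 3) ^ n| := by
      by_contra hle
      exact hy (max_eq_left (not_lt.1 hle))
    have h1 : 3 ^ n * G y - 1 = 3 ^ n * (G y - (1 / 3) ^ n) := by
      rw [mul_sub, ← mul_pow]; norm_num
    rw [h1, abs_mul, abs_of_pos (by positivity : (0 : ℝ) < 3 ^ n)]
    linarith
  have hlt (y : X) (m n : ℕ) (hm : |3 ^ m * G y - 1| < 1 / 4) (hn : |3 ^ n * G y - 1| < 1 / 4) :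
      ¬ m < n := by
    intro hmn
    obtain ⟨k, rfl⟩ := Nat.exists_eq_add_of_lt hmn
    have h3 : (1 : ℝ) ≤ 3 ^ k := one_le_pow₀ (by norm_num)
    rw [abs_lt] at hm hn
    have : (3 : ℝ) ^ (m + k + 1) * G y = 3 * 3 ^ k * (3 ^ m * G y) := by ring
    rw [this] at hn
    nlinarith
  refine ⟨fun n => x n, fun n => ⟨fun y => (g n y : 𝕜), by fun_prop⟩, fun n => (x n).2,
    fun n => ?_, fun y m n hm hn => ?_⟩
  · simp [g, hGx]
  · have hm' := hg m y fun h => hm (by simp [h])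
    have hn' := hg n y fun h => hn (by simp [h])
    exact le_antisymm (not_lt.1 (hlt y n m hn' hm')) (not_lt.1 (hlt y m n hm' hn'))

end Bump

/-! ### Pointwise bounded subsets of `L(X)` -/

section GlidingHump

/-- The solution of a lower triangular system of linear equations by forward substitution. -/
noncomputable def forwardSubst {K : Type*} [Field K] (t : ℕ → ℕ → K) (b : ℕ → K) : ℕ → K
  | n => (b n - ∑ j : Fin n, t n j * forwardSubst t b j) / t n n

theorem sum_mul_forwardSubst {K : Type*} [Field K] {t : ℕ → ℕ → K} (ht : ∀ n, t n n ≠ 0)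
    (b : ℕ → K) (n : ℕ) : ∑ j ∈ Finset.range (n + 1), t n j * forwardSubst t b j = b n := by
  rw [Finset.sum_range_succ, forwardSubst, mul_div_cancel₀ _ (ht n), Finset.sum_range]
  exact add_sub_cancel _ _

variable {𝕜 : Type*} [RCLike 𝕜] {X : Type*} [TopologicalSpace X] [T35Space X]

/-- The gliding hump argument: if the elements of `M ⊆ L(X)` have infinitely many support points
altogether, and `X` has no infinite functionally bounded subset, some `f ∈ C(X)` is unbounded on
these points. Along a sequence of elements `ν n` of `M` whose supports reach higher and higher
values of `‖f‖`, bumps at the new points form a locally finite family, and a suitable combination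
of them pairs with `ν n` to `n`. -/
theorem finite_iUnion_support_of_pointwise_bounded
    (hX : ¬ ∃ A : Set X, A.Infinite ∧ FunctionallyBounded 𝕜 A) {M : Set (FreeLSpace X 𝕜)}
    (hM : ∀ f : C(X, 𝕜), ∃ C : ℝ, ∀ μ ∈ M, ‖freePairing μ f‖ ≤ C) :
    (⋃ μ ∈ M, (μ.support : Set X)).Finite := by
  classical
  by_contra hinf
  obtain ⟨f, hf⟩ : ∃ f : C(X, 𝕜), ¬ Bornology.IsBounded (f '' ⋃ μ ∈ M, (μ.support : Set X)) := by
    by_contra! hb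
    exact hX ⟨_, hinf, hb⟩
  have hunb (R : ℝ) : ∃ μ ∈ M, ∃ x ∈ μ.support, R < ‖f x‖ := by
    by_contra! hb
    refine hf (isBounded_iff_forall_norm_le.2 ⟨R, ?_⟩)
    rintro _ ⟨x, hx, rfl⟩
    simp only [mem_iUnion, SetLike.mem_coe] at hx
    obtain ⟨μ, hμ, hx⟩ := hx
    exact hb μ hμ x hx
  obtain ⟨s, hsM, hs⟩ := exists_seq_of_forall_finset_exists
    (fun q : FreeLSpace X 𝕜 × X => q.1 ∈ M ∧ q.2 ∈ q.1.support)
    (fun q r => ∀ z ∈ q.1.support, ‖f z‖ + 1 ≤ ‖f r.2‖) (fun S _ => by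
      obtain ⟨R, hR⟩ := ((S.biUnion fun q => q.1.support).finite_toSet.image
        fun z => ‖f z‖).bddAbove
      obtain ⟨μ, hμ, x, hx, hRx⟩ := hunb (R + 1)
      refine ⟨(μ, x), ⟨hμ, hx⟩, fun q hq z hz => ?_⟩
      have := hR (mem_image_of_mem _ (Finset.mem_coe.2 (Finset.mem_biUnion.2 ⟨q, hq, hz⟩)))
      simp only at this ⊢
      linarith)
  set ν : ℕ → FreeLSpace X 𝕜 := fun n => (s n).1
  set x : ℕ → X := fun n => (s n).2
  -- The values of `‖f‖` at the new points tend to infinity, so each point of `X` has a neighbourhood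
  -- that meets only finitely many of the sets `W n` below.
  have hgrow (n : ℕ) : (n : ℝ) ≤ ‖f (x n)‖ := by
    induction n with
    | zero => simp
    | succ n ih =>
      have := hs n (n + 1) n.lt_succ_self (x n) (hsM n).2
      push_cast
      linarith
  let W : ℕ → Set X := fun n => {y | ‖f (x n)‖ - 1 < ‖f y‖} \ ((ν n).support \ {x n} : Set X)
  have hWo (n : ℕ) : IsOpen (W n) :=
    (isOpen_lt (by fun_prop) (by fun_prop)).sdiff
      ((ν n).support.finite_toSet.subset sdiff_subset).isClosed
  choose h hhx hhW using fun n => exists_bump 𝕜 (hWo n) (x := x n) (by simp [W])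
  have hsupp (n : ℕ) (y : X) (hy : h n y ≠ 0) : y ∈ W n := by
    by_contra hyW
    exact hy (hhW n y hyW)
  have hdiag (n : ℕ) : freePairing (ν n) (h n) = ν n (x n) :=
    freePairing_eq_apply (hhx n) fun y hy hyx => hhW n y fun hyW => hyW.2 ⟨hy, hyx⟩
  -- Bumps with index above `n` vanish on the support of `ν n`, so prescribing the pairings of
  -- `∑ c j • h j` with all `ν n` is a triangular system for `c`.
  let c := forwardSubst (fun n j => freePairing (ν n) (h j)) (fun n => (n : 𝕜))
  have hc := sum_mul_forwardSubst (t := fun n j => freePairing (ν n) (h j))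
    (fun n => by rw [hdiag]; exact Finsupp.mem_support_iff.1 (hsM n).2) (fun n => (n : 𝕜))
  have hlf : LocallyFinite fun n => Function.support fun y => c n * h n y := by
    intro y
    refine ⟨{z | ‖f z‖ < ‖f y‖ + 1}, (isOpen_lt (by fun_prop) (by fun_prop)).mem_nhds (by simp),
      (finite_le_nat ⌈‖f y‖ + 2⌉₊).subset ?_⟩
    rintro n ⟨z, hz, hzy⟩
    have h1 : ‖f (x n)‖ - 1 < ‖f z‖ := (hsupp n z (right_ne_zero_of_mul hz)).1
    have h2 : ‖f z‖ < ‖f y‖ + 1 := hzy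
    have h3 : (n : ℝ) ≤ ⌈‖f y‖ + 2⌉₊ := by linarith [hgrow n, Nat.le_ceil (‖f y‖ + 2)]
    exact_mod_cast h3
  let g : C(X, 𝕜) := ⟨fun y => ∑ᶠ n, c n * h n y, continuous_finsum (fun n => by fun_prop) hlf⟩
  have hg (n : ℕ) : freePairing (ν n) g = n := by
    have hgy (y : X) (hy : y ∈ (ν n).support) :
        g y = ∑ j ∈ Finset.range (n + 1), c j * h j y := by
      refine finsum_eq_sum_of_support_subset _ fun j hj => ?_
      by_contra hjn
      have h1 := hs n j (by simpa using hjn) y hy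
      have h2 : ‖f (x j)‖ - 1 < ‖f y‖ := (hsupp j y (right_ne_zero_of_mul hj)).1
      simp only [x] at h2
      linarith
    rw [← hc n, freePairing_eq_sum, Finset.sum_congr rfl fun y hy => by rw [hgy y hy]]
    simp_rw [Finset.mul_sum]
    rw [Finset.sum_comm]
    refine Finset.sum_congr rfl fun j _ => ?_
    rw [freePairing_eq_sum, Finset.sum_mul]
    exact Finset.sum_congr rfl fun y _ => by ring
  obtain ⟨C, hC⟩ := hM g
  obtain ⟨n, hn⟩ := exists_nat_gt C
  have := hC (ν n) (hsM n).1
  rw [hg, RCLike.norm_natCast] at this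
  linarith

/-- Under the absence of infinite functionally bounded subsets, the pointwise bounded subsets of
`L(X)` are the obvious ones: common finite support, and bounded coefficients. -/
theorem exists_finset_bound_of_pointwise_bounded
    (hX : ¬ ∃ A : Set X, A.Infinite ∧ FunctionallyBounded 𝕜 A) {M : Set (FreeLSpace X 𝕜)}
    (hM : ∀ f : C(X, 𝕜), ∃ C : ℝ, ∀ μ ∈ M, ‖freePairing μ f‖ ≤ C) :
    ∃ (F : Finset X) (C : ℝ), 0 ≤ C ∧ ∀ μ ∈ M, μ.support ⊆ F ∧ ∀ x, ‖μ x‖ ≤ C := by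
  have hfin := finite_iUnion_support_of_pointwise_bounded hX hM
  have hF (μ) (hμ : μ ∈ M) : μ.support ⊆ hfin.toFinset := fun x hx => by
    simp only [Finite.mem_toFinset, mem_iUnion]
    exact ⟨μ, hμ, hx⟩
  choose f hfx hf using fun x => exists_bump_finset 𝕜 hfin.toFinset x
  choose C hC using fun x => hM (f x)
  refine ⟨hfin.toFinset, ∑ x ∈ hfin.toFinset, |C x|, Finset.sum_nonneg fun _ _ => abs_nonneg _,
    fun μ hμ => ⟨hF μ hμ, fun x => ?_⟩⟩
  by_cases hx : x ∈ hfin.toFinset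
  · rw [← freePairing_eq_apply (hfx x) fun y hy => hf x y (hF μ hμ hy)]
    exact (hC x μ hμ).trans ((le_abs_self _).trans
      (Finset.single_le_sum (f := fun x => |C x|) (fun _ _ => abs_nonneg _) hx))
  · rw [Finsupp.notMem_support_iff.1 fun h => hx (hF μ hμ h), norm_zero]
    exact Finset.sum_nonneg fun _ _ => abs_nonneg _

end GlidingHump

/-! ### The classes `ℓ_p` and `c₀` -/

namespace MemEllOrC0

variable {F G : Type*} [NormedAddCommGroup F] [NormedAddCommGroup G] {p q : ℝ≥0∞}

theorem tendsto_zero (hp : 1 ≤ p) {a : ℕ → F} (ha : MemEllOrC0 p a) :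
    Tendsto a atTop (𝓝 0) := by
  by_cases hp' : p = ∞
  · exact ha.2 hp'
  · have h0 : 0 < p.toReal := ENNReal.toReal_pos (by positivity) hp'
    have h1 := ((ha.1 hp').summable h0).tendsto_atTop_zero.rpow_const (p := p.toReal⁻¹)
      (Or.inr (by positivity))
    rw [Real.zero_rpow (by positivity)] at h1
    refine tendsto_zero_iff_norm_tendsto_zero.2 (h1.congr fun n => ?_)
    exact Real.rpow_rpow_inv (norm_nonneg _) h0.ne'

theorem mono_exponent (hp : 1 ≤ p) (hpq : p ≤ q) {a : ℕ → F} (ha : MemEllOrC0 p a) :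
    MemEllOrC0 q a :=
  ⟨fun hq => (ha.1 (ne_top_of_le_ne_top hq hpq)).of_exponent_ge hpq, fun _ => ha.tendsto_zero hp⟩

theorem of_norm_le {a : ℕ → F} {b : ℕ → ℝ} (hb : MemEllOrC0 p b) (h : ∀ n, ‖a n‖ ≤ b n) :
    MemEllOrC0 p a :=
  ⟨fun hp => (hb.1 hp).mono h, fun hp => squeeze_zero_norm h (hb.2 hp)⟩

theorem norm {a : ℕ → F} (ha : MemEllOrC0 p a) : MemEllOrC0 p fun n => ‖a n‖ :=
  ⟨fun hp => (ha.1 hp).norm, fun hp => tendsto_zero_iff_norm_tendsto_zero.1 (ha.2 hp)⟩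

theorem mul_const {a : ℕ → ℝ} (ha : MemEllOrC0 p a) (c : ℝ) : MemEllOrC0 p fun n => a n * c :=
  ⟨fun hp => by simpa only [mul_comm] using (ha.1 hp).const_mul c,
    fun hp => by simpa using (ha.2 hp).mul_const c⟩

theorem finset_sum {ι : Type*} (s : Finset ι) {a : ι → ℕ → F}
    (ha : ∀ i ∈ s, MemEllOrC0 p (a i)) : MemEllOrC0 p fun n => ∑ i ∈ s, a i n :=
  ⟨fun hp => Memℓp.finsetSum s fun i hi => (ha i hi).1 hp,
    fun hp => by simpa using tendsto_finsetSum s fun i hi => (ha i hi).2 hp⟩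

end MemEllOrC0

/-! ### Weak* summable sequences and limited sets -/

section Dual

variable {𝕜 : Type*} [RCLike 𝕜] {E : Type*} [AddCommGroup E] [Module 𝕜 E] [TopologicalSpace E]

/-- The weak* dual has no continuous functionals besides the evaluations, so weak*
`p`-summability is a condition on the values at the points of `E`. -/
theorem weakStarPSummable_iff {p : ℝ≥0∞} {χ : ℕ → WeakDual 𝕜 E} :
    WeakStarPSummable 𝕜 p χ ↔ ∀ x : E, MemEllOrC0 p fun n => χ n x := by
  constructor
  · intro h x
    exact h (WeakBilin.eval (topDualPairing 𝕜 E) x)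
  · intro h φ
    obtain ⟨x, hx⟩ := LinearMap.dualEmbedding_surjective (topDualPairing 𝕜 E) φ
    rw [← hx]
    exact h x

theorem bddAbove_norm_image_of_isVonNBounded {B : Set E} (hB : Bornology.IsVonNBounded 𝕜 B)
    (φ : E →L[𝕜] 𝕜) : BddAbove ((fun a => ‖φ a‖) '' B) := by
  obtain ⟨C, hC⟩ := ((NormedSpace.isVonNBounded_iff' 𝕜).1 (hB.image φ))
  refine ⟨C, ?_⟩
  rintro _ ⟨a, ha, rfl⟩
  exact hC _ (mem_image_of_mem _ ha)

theorem IsPQLimited.mono_exponent {p q r : ℝ≥0∞} (hq : 1 ≤ q) (hqr : q ≤ r) {A : Set E}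
    (hA : IsPQLimited 𝕜 p q A) : IsPQLimited 𝕜 p r A :=
  ⟨hA.1, fun χ hχ => ⟨(hA.2 χ hχ).1, (hA.2 χ hχ).2.mono_exponent hq hqr⟩⟩

/-- An equicontinuous sequence of functionals that tends to zero pointwise tends to zero uniformly
on precompact sets. -/
theorem IsPBarrelled.isPQLimited_top [ContinuousConstSMul 𝕜 E] {p : ℝ≥0∞} (hp : 1 ≤ p)
    (hE : IsPBarrelled 𝕜 E p) {B : Set E} (hne : B.Nonempty) (hB : IsPrecompactSet B)
    (hb : Bornology.IsVonNBounded 𝕜 B) : IsPQLimited 𝕜 p ∞ B := by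
  refine ⟨hne, fun χ hχ => ⟨fun n => bddAbove_norm_image_of_isVonNBounded hb (χ n), by simp, ?_⟩⟩
  intro _
  obtain ⟨U, hU, hχU⟩ := hE χ hχ
  rw [Metric.tendsto_nhds]
  intro ε hε
  have hc : ((ε / 3 : ℝ) : 𝕜) ≠ 0 := by exact_mod_cast (by positivity : (ε / 3 : ℝ) ≠ 0)
  obtain ⟨F, hF, hBF⟩ := hB (((ε / 3 : ℝ) : 𝕜) • U)
    (by simpa using smul_mem_nhds_smul₀ hc hU)
  have hev : ∀ᶠ n in atTop, ∀ f ∈ F, ‖χ n f‖ < ε / 3 := by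
    rw [eventually_all_finite hF]
    intro f _
    have h0 := (weakStarPSummable_iff.1 hχ f).tendsto_zero hp
    exact (tendsto_zero_iff_norm_tendsto_zero.1 h0).eventually_lt_const (by positivity)
  filter_upwards [hev] with n hn
  have hnn : 0 ≤ sSup ((fun a => ‖χ n a‖) '' B) :=
    Real.sSup_nonneg (by rintro _ ⟨a, _, rfl⟩; exact norm_nonneg _)
  rw [Real.dist_eq, sub_zero, abs_of_nonneg hnn]
  refine (csSup_le (hne.image _) ?_).trans_lt (by linarith : ε / 3 + ε / 3 < ε)
  rintro _ ⟨b, hb', rfl⟩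
  obtain ⟨f, hf, _, ⟨u, hu, rfl⟩, rfl⟩ := hBF hb'
  simp only [map_add, map_smul]
  refine (norm_add_le _ _).trans (add_le_add (hn f hf).le ?_)
  rw [norm_smul, RCLike.norm_ofReal, abs_of_pos (by positivity)]
  exact mul_le_of_le_one_right (by positivity) (hχU _ (mem_range_self n) u hu)

end Dual

/-! ### Bounded sets and continuous functionals of `C_p(X)` -/

section FunctionSpace

variable {𝕜 : Type*} [RCLike 𝕜] {X : Type*} [TopologicalSpace X]

theorem Cp.isInducing_val : IsInducing (fun f : Cp X 𝕜 => (f : X → 𝕜)) := .subtypeVal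

theorem Cp.isUniformAddGroup : IsUniformAddGroup (Cp X 𝕜) :=
  inferInstanceAs (IsUniformAddGroup (continuousSubmodule X 𝕜 𝕜).toAddSubgroup)

/-- The Dirac functional at `x` on `C_p(X)`. -/
def Cp.eval (x : X) : Cp X 𝕜 →L[𝕜] 𝕜 :=
  (ContinuousLinearMap.proj (φ := fun _ : X => 𝕜) x).comp (Submodule.subtypeL _)

/-- A continuous function, as an element of `C_p(X)`. -/
def Cp.mk (f : C(X, 𝕜)) : Cp X 𝕜 := ⟨f, f.continuous⟩

theorem Cp.exists_bound {B : Set (Cp X 𝕜)} (hB : Bornology.IsVonNBounded 𝕜 B) (x : X) :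
    ∃ C : ℝ, ∀ f ∈ B, ‖(f : X → 𝕜) x‖ ≤ C := by
  obtain ⟨C, hC⟩ := bddAbove_norm_image_of_isVonNBounded hB (Cp.eval x)
  exact ⟨C, fun f hf => hC ⟨f, hf, rfl⟩⟩

/-- A pointwise bounded set of functions is a subset of a product of compact discs. -/
theorem Cp.totallyBounded_of_pointwise {B : Set (Cp X 𝕜)}
    (hB : ∀ x, ∃ C : ℝ, ∀ f ∈ B, ‖(f : X → 𝕜) x‖ ≤ C) : TotallyBounded B := by
  choose C hC using hB
  refine (totallyBounded_image_iff (f := fun f : Cp X 𝕜 => (f : X → 𝕜))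
    isUniformEmbedding_subtype_val.isUniformInducing).1 ?_
  refine (isCompact_univ_pi fun x => isCompact_closedBall (0 : 𝕜) (C x)).totallyBounded.subset ?_
  rintro _ ⟨f, hf, rfl⟩ x _
  simpa using hC x f hf

theorem Cp.isPrecompactSet_iff_totallyBounded {B : Set (Cp X 𝕜)} :
    IsPrecompactSet B ↔ TotallyBounded B := by
  have := Cp.isUniformAddGroup (𝕜 := 𝕜) (X := X)
  rw [totallyBounded_iff_subset_finite_iUnion_nhds_zero]
  refine forall₂_congr fun U _ => exists_congr fun F => and_congr_right fun _ => ?_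
  rw [← vadd_eq_add, ← iUnion_vadd_set]

theorem Cp.isPrecompactSet_iff_isVonNBounded {B : Set (Cp X 𝕜)} :
    IsPrecompactSet B ↔ Bornology.IsVonNBounded 𝕜 B := by
  have := Cp.isUniformAddGroup (𝕜 := 𝕜) (X := X)
  rw [Cp.isPrecompactSet_iff_totallyBounded]
  exact ⟨fun h => h.isVonNBounded 𝕜, fun h => Cp.totallyBounded_of_pointwise (Cp.exists_bound h)⟩

/-- The dual of `C_p(X)` is `L(X)`. -/
theorem Cp.exists_eq_freePairing (χ : Cp X 𝕜 →L[𝕜] 𝕜) :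
    ∃ μ : FreeLSpace X 𝕜, ∀ f : C(X, 𝕜), χ (Cp.mk f) = freePairing μ f := by
  have h : (χ : Cp X 𝕜 →ₗ[𝕜] 𝕜) ∈ Submodule.span 𝕜
      (range fun x : X => (Cp.eval x : Cp X 𝕜 →L[𝕜] 𝕜).toLinearMap) := by
    rw [LinearMap.mem_span_iff_continuous]
    have hi : (⨅ x : X, TopologicalSpace.induced (fun f : Cp X 𝕜 => (f : X → 𝕜) x) inferInstance) =
        (inferInstance : TopologicalSpace (Cp X 𝕜)) := by
      rw [Cp.isInducing_val.eq_induced, Pi.topologicalSpace, induced_iInf]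
      simp only [induced_compose]
      rfl
    exact continuous_iff_le_induced.2 (hi.le.trans χ.continuous.le_induced)
  obtain ⟨μ, hμ⟩ := Finsupp.mem_span_range_iff_exists_finsupp.1 h
  refine ⟨μ, fun f => ?_⟩
  have := LinearMap.congr_fun hμ (Cp.mk f)
  simp only [Finsupp.sum, LinearMap.sum_apply, LinearMap.smul_apply, smul_eq_mul] at this
  exact this.symm

variable [T35Space X]

/-- If `X` has no infinite functionally bounded subset, a weak* `p`-summable sequence in the dual
of `C_p(X)` lives on a finite set of points, where its coefficients form `ℓ_p` sequences. -/
theorem exists_finset_of_weakStarPSummable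
    (hX : ¬ ∃ A : Set X, A.Infinite ∧ FunctionallyBounded 𝕜 A) {p : ℝ≥0∞} (hp : 1 ≤ p)
    {χ : ℕ → WeakDual 𝕜 (Cp X 𝕜)} (hχ : WeakStarPSummable 𝕜 p χ) :
    ∃ (F : Finset X) (a : X → ℕ → 𝕜) (C : ℝ), 0 ≤ C ∧ (∀ x n, ‖a x n‖ ≤ C) ∧
      (∀ x ∈ F, MemEllOrC0 p (a x)) ∧
      ∀ n (f : Cp X 𝕜), χ n f = ∑ x ∈ F, a x n * (f : X → 𝕜) x := by
  rw [weakStarPSummable_iff] at hχ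
  choose μ hμ using fun n => Cp.exists_eq_freePairing (χ n)
  obtain ⟨F, C, hC, hFC⟩ := exists_finset_bound_of_pointwise_bounded hX (M := range μ) fun f => by
    obtain ⟨C, hC⟩ := ((hχ (Cp.mk f)).tendsto_zero hp).norm.bddAbove_range
    refine ⟨C, ?_⟩
    rintro _ ⟨n, rfl⟩
    rw [← hμ]
    exact hC ⟨n, rfl⟩
  have hF (n) : (μ n).support ⊆ F := (hFC _ ⟨n, rfl⟩).1
  refine ⟨F, fun x n => μ n x, C, hC, fun x n => (hFC _ ⟨n, rfl⟩).2 x, fun x _ => ?_,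
    fun n f => ?_⟩
  · obtain ⟨h, hhx, hh⟩ := exists_bump_finset 𝕜 F x
    have := hχ (Cp.mk h)
    exact (congrArg (MemEllOrC0 p) (funext fun n => (hμ n h).trans
      (freePairing_eq_apply hhx fun y hy => hh y (hF n hy)))).mp this
  · exact (hμ n ⟨f, f.2⟩).trans (freePairing_eq_sum_of_subset (hF n) _)

theorem isPBarrelled_of_no_infinite_functionallyBounded
    (hX : ¬ ∃ A : Set X, A.Infinite ∧ FunctionallyBounded 𝕜 A) {p : ℝ≥0∞} (hp : 1 ≤ p) :
    IsPBarrelled 𝕜 (Cp X 𝕜) p := by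
  intro χ hχ
  obtain ⟨F, a, C, hC, haC, -, hχa⟩ := exists_finset_of_weakStarPSummable hX hp hχ
  refine ⟨⋂ x ∈ F, {f | ‖(f : X → 𝕜) x‖ < (F.card * C + 1)⁻¹},
    (biInter_finset_mem F).2 fun x _ => ?_, ?_⟩
  · refine (isOpen_lt (Cp.eval x).continuous.norm continuous_const).mem_nhds ?_
    change ‖(0 : 𝕜)‖ < _
    rw [norm_zero]
    positivity
  · rintro _ ⟨n, rfl⟩ f hf
    rw [mem_iInter₂] at hf
    rw [hχa]
    calc ‖∑ x ∈ F, a x n * (f : X → 𝕜) x‖ ≤ ∑ x ∈ F, C * (F.card * C + 1)⁻¹ :=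
          norm_sum_le_of_le _ fun x hx => by
            rw [norm_mul]
            exact mul_le_mul (haC x n) (hf x hx).le (norm_nonneg _) hC
      _ = F.card * C / (F.card * C + 1) := by
          rw [Finset.sum_const, nsmul_eq_mul]; ring
      _ ≤ 1 := div_le_one_of_le₀ (by linarith) (by positivity)

theorem isPQLimited_of_no_infinite_functionallyBounded
    (hX : ¬ ∃ A : Set X, A.Infinite ∧ FunctionallyBounded 𝕜 A) {p q : ℝ≥0∞} (hp : 1 ≤ p)
    (hpq : p ≤ q) {B : Set (Cp X 𝕜)} (hne : B.Nonempty) (hB : Bornology.IsVonNBounded 𝕜 B) :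
    IsPQLimited 𝕜 p q B := by
  refine IsPQLimited.mono_exponent hp hpq ⟨hne, fun χ hχ =>
    ⟨fun n => bddAbove_norm_image_of_isVonNBounded hB (χ n), ?_⟩⟩
  obtain ⟨F, a, -, -, -, ha, hχa⟩ := exists_finset_of_weakStarPSummable hX hp hχ
  choose D hD using Cp.exists_bound hB
  refine (MemEllOrC0.finset_sum F fun x hx => (ha x hx).norm.mul_const (D x)).of_norm_le
    fun n => ?_
  rw [Real.norm_of_nonneg (Real.sSup_nonneg (by rintro _ ⟨f, _, rfl⟩; exact norm_nonneg _))]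
  refine csSup_le (hne.image _) ?_
  rintro _ ⟨f, hf, rfl⟩
  simp only [hχa]
  refine norm_sum_le_of_le _ fun x _ => ?_
  rw [norm_mul]
  exact mul_le_mul_of_nonneg_left (hD x f hf) (norm_nonneg _)

/-- If `A` is infinite and functionally bounded, then for disjoint bumps `h n` at points `x n` of
`A` the functionals `2⁻ⁿ δ_{x n}` are weak* summable, while the functions `2ⁿ h n` form a bounded
set on which they do not tend to zero uniformly. -/
theorem no_infinite_functionallyBounded_of_isPQLimited_top {p : ℝ≥0∞} (hp : 1 ≤ p)
    (hlim : ∀ B : Set (Cp X 𝕜), B.Nonempty → Bornology.IsVonNBounded 𝕜 B → IsPQLimited 𝕜 p ∞ B) :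
    ¬ ∃ A : Set X, A.Infinite ∧ FunctionallyBounded 𝕜 A := by
  rintro ⟨A, hA, hAb⟩
  obtain ⟨x, h, hxA, hhx, hdisj⟩ := exists_seq_disjoint_bumps 𝕜 hA
  let χ : ℕ → WeakDual 𝕜 (Cp X 𝕜) := fun n =>
    StrongDual.toWeakDual (((2 : 𝕜)⁻¹ ^ n) • (Cp.eval (x n) : Cp X 𝕜 →L[𝕜] 𝕜))
  have hχ (n : ℕ) (f : Cp X 𝕜) : χ n f = (2 : 𝕜)⁻¹ ^ n * (f : X → 𝕜) (x n) := rfl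
  have hsum : WeakStarPSummable 𝕜 p χ := by
    refine weakStarPSummable_iff.2 fun f => ?_
    obtain ⟨C, hC⟩ := isBounded_iff_forall_norm_le.1 (hAb ⟨f, f.2⟩)
    have hgeo : MemEllOrC0 1 fun n => ((2 : ℝ)⁻¹) ^ n := by
      refine ⟨fun _ => memℓp_gen ?_, by simp⟩
      simpa using summable_geometric_of_lt_one (r := (2 : ℝ)⁻¹) (by norm_num) (by norm_num)
    refine ((hgeo.mul_const C).of_norm_le fun n => ?_).mono_exponent le_rfl hp
    rw [hχ, norm_mul, norm_pow, norm_inv, RCLike.norm_ofNat]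
    exact mul_le_mul_of_nonneg_left (hC _ ⟨x n, hxA n, rfl⟩) (by positivity)
  let b : ℕ → Cp X 𝕜 := fun n => (2 : 𝕜) ^ n • Cp.mk (h n)
  have hb (n : ℕ) (y : X) : (b n : X → 𝕜) y = (2 : 𝕜) ^ n * h n y := rfl
  have hbdd : Bornology.IsVonNBounded 𝕜 (range b) := by
    refine Cp.isPrecompactSet_iff_isVonNBounded.1 (Cp.isPrecompactSet_iff_totallyBounded.2
      (Cp.totallyBounded_of_pointwise fun y => ?_))
    by_cases hy : ∃ m, h m y ≠ 0
    · obtain ⟨m, hm⟩ := hy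
      refine ⟨‖(b m : X → 𝕜) y‖, ?_⟩
      rintro _ ⟨n, rfl⟩
      by_cases hn : h n y = 0
      · simp [hb, hn]
      · rw [hdisj y n m hn hm]
    · push Not at hy
      refine ⟨0, ?_⟩
      rintro _ ⟨n, rfl⟩
      simp [hb, hy]
  obtain ⟨hbd, hlim0⟩ := (hlim _ (range_nonempty b) hbdd).2 χ hsum
  have h1 (n : ℕ) : 1 ≤ sSup ((fun a => ‖χ n a‖) '' range b) := by
    refine le_csSup (hbd n) ⟨b n, mem_range_self n, ?_⟩
    simp only [hχ, hb, hhx, mul_one]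
    rw [← mul_pow, inv_mul_cancel₀ two_ne_zero, one_pow, norm_one]
  exact absurd (ge_of_tendsto' (hlim0.2 rfl) h1) (by norm_num)

end FunctionSpace

/-! ### Weakly bounded sets -/

section Mackey

variable {𝕜 : Type*} [RCLike 𝕜] {E : Type*} [AddCommGroup E] [Module 𝕜 E]

/-- Mackey's theorem for a single seminorm: a family on which every linear functional dominated by
`p` up to a constant is bounded, is bounded for `p`. By the Hahn-Banach theorem `p` is the norm in
the bidual of `(E, p)`, and the Banach-Steinhaus theorem applies on the dual. -/
theorem Seminorm.exists_bound_of_forall_dual (p : Seminorm 𝕜 E) {ι : Type*} {x : ι → E}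
    (h : ∀ φ : E →ₗ[𝕜] 𝕜, (∃ K : ℝ, ∀ y, ‖φ y‖ ≤ K * p y) → ∃ C : ℝ, ∀ i, ‖φ (x i)‖ ≤ C) :
    ∃ C : ℝ, ∀ i, p (x i) ≤ C := by
  let _ : SeminormedAddCommGroup E := p.toSeminormedAddCommGroup
  let _ : NormedSpace 𝕜 E := ⟨fun a y => (map_smul_eq_mul p a y).le⟩
  obtain ⟨C, hC⟩ := banach_steinhaus (g := fun i => NormedSpace.inclusionInDoubleDual 𝕜 E (x i))
    fun φ => h φ.toLinearMap ⟨‖φ‖, φ.le_opNorm⟩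
  refine ⟨C, fun i => ?_⟩
  obtain ⟨φ, hφ, hφx⟩ := exists_dual_vector'' 𝕜 (x i)
  have h1 : ‖φ (x i)‖ ≤ C :=
    ((NormedSpace.inclusionInDoubleDual 𝕜 E (x i)).le_opNorm φ).trans
      ((mul_le_of_le_one_right (norm_nonneg _) hφ).trans (hC i))
  rwa [hφx, RCLike.norm_ofReal, abs_of_nonneg (norm_nonneg _)] at h1

end Mackey

section Polynormable

open scoped ComplexOrder in
/-- Convexity over `𝕜` amounts to convexity over `ℝ`, as the non-negative elements of `𝕜` are
real, so local convexity over `ℝ` gives a defining family of `𝕜`-seminorms. -/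
theorem LocallyConvexSpace.polynormableSpace_of_real (𝕜 : Type*) [RCLike 𝕜] (E : Type*)
    [AddCommGroup E] [Module 𝕜 E] [Module ℝ E] [IsScalarTower ℝ 𝕜 E] [TopologicalSpace E]
    [IsTopologicalAddGroup E] [ContinuousSMul 𝕜 E] [LocallyConvexSpace ℝ E] :
    PolynormableSpace 𝕜 E := by
  have : LocallyConvexSpace 𝕜 E :=
    ⟨fun x => (LocallyConvexSpace.convex_basis (𝕜 := ℝ) x).to_hasBasis
      (fun s hs => ⟨s, ⟨hs.1, convex_of_nonneg_surjective_algebraMap _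
        (fun _ => RCLike.nonneg_iff_exists_ofReal.mp) hs.2⟩, subset_rfl⟩)
      fun s hs => ⟨s, ⟨hs.1, hs.2.lift ℝ⟩, subset_rfl⟩⟩
  have : ContinuousSMul ℝ E := IsScalarTower.continuousSMul 𝕜
  exact LocallyConvexSpace.toPolynormableSpace

end Polynormable

/-! ### Completeness of `L(X)` in a compatible topology -/

section Completeness

theorem seminorm_single_le {𝕜 X : Type*} [RCLike 𝕜] {p : Seminorm 𝕜 (FreeLSpace X 𝕜)} {x : X}
    {C : ℝ}
    (h : p (Finsupp.single x 1) ≤ C) (c : 𝕜) : p (Finsupp.single x c) ≤ ‖c‖ * C := by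
  have : Finsupp.single x c = c • Finsupp.single x (1 : 𝕜) := by simp
  rw [this, map_smul_eq_mul]
  exact mul_le_mul_of_nonneg_left h (norm_nonneg c)

open scoped ComplexOrder in
/-- The elements of `L(X)` with support in `F` and coefficients bounded by `C` form a compact
absolutely convex set: it is a linear image of a finite product of discs. -/
theorem exists_isCompact_absConvex {𝕜 X : Type*} [RCLike 𝕜] [TopologicalSpace (FreeLSpace X 𝕜)]
    [IsTopologicalAddGroup (FreeLSpace X 𝕜)] [ContinuousSMul 𝕜 (FreeLSpace X 𝕜)]
    (F : Finset X) (C : ℝ) :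
    ∃ K : Set (FreeLSpace X 𝕜), IsCompact K ∧ AbsConvex 𝕜 K ∧
      ∀ μ : FreeLSpace X 𝕜, μ.support ⊆ F → (∀ x, ‖μ x‖ ≤ C) → μ ∈ K := by
  let T : (F → 𝕜) →ₗ[𝕜] FreeLSpace X 𝕜 :=
    ∑ x : F, (Finsupp.lsingle (x : X)).comp (LinearMap.proj x)
  have hTc : Continuous T := T.continuous_of_finiteDimensional
  have hT (a : F → 𝕜) : T a = ∑ x : F, Finsupp.single (x : X) (a x) := by
    simp [T, LinearMap.sum_apply]
  let D : Set (F → 𝕜) := univ.pi fun _ => Metric.closedBall 0 C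
  have hD (a : F → 𝕜) : a ∈ D ↔ ∀ x, ‖a x‖ ≤ C := by simp [D]
  refine ⟨T '' D, (isCompact_univ_pi fun _ => isCompact_closedBall _ _).image hTc, ⟨?_, ?_⟩, ?_⟩
  · rintro c hc _ ⟨_, ⟨a, ha, rfl⟩, rfl⟩
    refine ⟨c • a, (hD _).2 fun x => ?_, map_smul T c a⟩
    rw [Pi.smul_apply, norm_smul]
    exact (mul_le_of_le_one_left (norm_nonneg _) hc).trans ((hD a).1 ha x)
  · refine Convex.linear_image ?_ T
    exact convex_of_nonneg_surjective_algebraMap _ (fun _ => RCLike.nonneg_iff_exists_ofReal.mp)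
      (convex_pi fun _ _ => convex_closedBall (0 : 𝕜) C)
  · intro μ hμF hμC
    refine ⟨fun x => μ x, (hD _).2 fun x => hμC x, ?_⟩
    rw [hT, Finset.sum_coe_sort F fun x => Finsupp.single x (μ x)]
    conv_rhs => rw [← Finsupp.sum_single μ]
    exact (Finsupp.sum_of_support_subset μ hμF _ (by simp)).symm

variable {𝕜 : Type*} [RCLike 𝕜] {X : Type*} [TopologicalSpace X]

/-- The functional `⟨·, f⟩` on `L(X)` in a compatible topology. -/
noncomputable def freePairingCLM [TopologicalSpace (FreeLSpace X 𝕜)]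
    (hT : CompatibleWithDuality X 𝕜) (f : C(X, 𝕜)) : FreeLSpace X 𝕜 →L[𝕜] 𝕜 :=
  ⟨Finsupp.linearCombination 𝕜 f,
    (hT _).2 ⟨f, fun μ => (freePairing_eq_linearCombination μ f).symm⟩⟩

theorem freePairingCLM_apply [TopologicalSpace (FreeLSpace X 𝕜)]
    (hT : CompatibleWithDuality X 𝕜) (f : C(X, 𝕜)) (μ : FreeLSpace X 𝕜) :
    freePairingCLM hT f μ = freePairing μ f := (freePairing_eq_linearCombination μ f).symm

theorem CompatibleWithDuality.t2Space [T35Space X] [TopologicalSpace (FreeLSpace X 𝕜)]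
    (hT : CompatibleWithDuality X 𝕜) : T2Space (FreeLSpace X 𝕜) := by
  classical
  refine (t2Space_iff _).2 fun μ ν hμν => ?_
  obtain ⟨x, hx⟩ := Finsupp.ne_iff.1 hμν
  obtain ⟨f, hfx, hf⟩ := exists_bump_finset 𝕜 (μ.support ∪ ν.support) x
  refine separated_by_continuous (freePairingCLM hT f).continuous ?_
  rwa [freePairingCLM_apply, freePairingCLM_apply,
    freePairing_eq_apply hfx fun y hy => hf y (Finset.mem_union_left _ hy),
    freePairing_eq_apply hfx fun y hy => hf y (Finset.mem_union_right _ hy)]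

theorem exists_bound_freePairing_of_isVonNBounded [TopologicalSpace (FreeLSpace X 𝕜)]
    (hT : CompatibleWithDuality X 𝕜) {M : Set (FreeLSpace X 𝕜)}
    (hM : Bornology.IsVonNBounded 𝕜 M) (f : C(X, 𝕜)) :
    ∃ C : ℝ, ∀ μ ∈ M, ‖freePairing μ f‖ ≤ C := by
  obtain ⟨C, hC⟩ := bddAbove_norm_image_of_isVonNBounded hM (freePairingCLM hT f)
  exact ⟨C, fun μ hμ => by
    rw [← freePairingCLM_apply hT]
    exact hC ⟨μ, hμ, rfl⟩⟩

open scoped ComplexOrder in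
theorem exists_isCompact_absConvex_superset [T35Space X] [TopologicalSpace (FreeLSpace X 𝕜)]
    [IsTopologicalAddGroup (FreeLSpace X 𝕜)] [ContinuousSMul 𝕜 (FreeLSpace X 𝕜)]
    (hT : CompatibleWithDuality X 𝕜)
    (hX : ¬ ∃ A : Set X, A.Infinite ∧ FunctionallyBounded 𝕜 A) {M : Set (FreeLSpace X 𝕜)}
    (hM : Bornology.IsVonNBounded 𝕜 M) :
    ∃ K : Set (FreeLSpace X 𝕜), IsCompact K ∧ AbsConvex 𝕜 K ∧ M ⊆ K := by
  obtain ⟨F, C, -, hFC⟩ := exists_finset_bound_of_pointwise_bounded hX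
    (exists_bound_freePairing_of_isVonNBounded hT hM)
  obtain ⟨K, hK, hKc, hKF⟩ := exists_isCompact_absConvex (𝕜 := 𝕜) F C
  exact ⟨K, hK, hKc, fun μ hμ => hKF μ (hFC μ hμ).1 (hFC μ hμ).2⟩

open scoped ComplexOrder in
theorem isLocallyCompleteSpace_of_no_infinite_functionallyBounded [T35Space X]
    [TopologicalSpace (FreeLSpace X 𝕜)] [IsTopologicalAddGroup (FreeLSpace X 𝕜)]
    [ContinuousSMul 𝕜 (FreeLSpace X 𝕜)] (hT : CompatibleWithDuality X 𝕜)
    (hX : ¬ ∃ A : Set X, A.Infinite ∧ FunctionallyBounded 𝕜 A) :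
    IsLocallyCompleteSpace 𝕜 (FreeLSpace X 𝕜) := by
  intro x hx
  have := hT.t2Space
  obtain ⟨K, hK, hKc, hxK⟩ :=
    exists_isCompact_absConvex_superset hT hX (hx.isVonNBounded_range 𝕜)
  exact hK.of_isClosed_subset isClosed_closedAbsConvexHull
    (closedAbsConvexHull_min hxK hKc hK.isClosed)

theorem quasiCompleteSpace_of_no_infinite_functionallyBounded [T35Space X]
    [UniformSpace (FreeLSpace X 𝕜)] [IsUniformAddGroup (FreeLSpace X 𝕜)]
    [ContinuousSMul 𝕜 (FreeLSpace X 𝕜)] (hT : CompatibleWithDuality X 𝕜)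
    (hX : ¬ ∃ A : Set X, A.Infinite ∧ FunctionallyBounded 𝕜 A) :
    QuasiCompleteSpace 𝕜 (FreeLSpace X 𝕜) := by
  refine ⟨fun M hM hMc => ?_⟩
  obtain ⟨K, hK, -, hMK⟩ := exists_isCompact_absConvex_superset hT hX hM
  exact (hK.of_isClosed_subset hMc hMK).isComplete

theorem QuasiCompleteSpace.isSequentiallyComplete {E : Type*} [AddCommGroup E] [Module 𝕜 E]
    [UniformSpace E] [IsUniformAddGroup E] [ContinuousSMul 𝕜 E] (hE : QuasiCompleteSpace 𝕜 E) :
    IsSequentiallyComplete E := by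
  intro x hx
  have hK := isCompact_closure_of_totallyBounded_quasiComplete (𝕜 := 𝕜) hx.totallyBounded_range
  obtain ⟨y, -, hy⟩ := cauchySeq_tendsto_of_isComplete hK.isComplete
    (fun n => subset_closure (mem_range_self n)) hx
  exact ⟨y, hy⟩

/-- With disjoint bumps `h n` at the points `x n`, a cluster point of the partial sums of
`∑ c k δ_{x k}` would pair with each `h n` to `c n ≠ 0`, and so would have infinite support. -/
theorem not_mapClusterPt_sum_single [TopologicalSpace (FreeLSpace X 𝕜)]
    (hT : CompatibleWithDuality X 𝕜) {x : ℕ → X} {h : ℕ → C(X, 𝕜)} (hhx : ∀ n, h n (x n) = 1)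
    (hdisj : ∀ y m n, h m y ≠ 0 → h n y ≠ 0 → m = n) {c : ℕ → 𝕜} (hc : ∀ n, c n ≠ 0)
    (ν : FreeLSpace X 𝕜) :
    ¬ MapClusterPt ν atTop fun n => ∑ k ∈ Finset.range n, Finsupp.single (x k) (c k) := by
  intro hν
  have hpair (m : ℕ) : freePairing ν (h m) = c m := by
    have h1 := hν.continuousAt_comp (freePairingCLM hT (h m)).continuous.continuousAt
    have h2 : Tendsto (freePairingCLM hT (h m) ∘
        fun n => ∑ k ∈ Finset.range n, Finsupp.single (x k) (c k)) atTop (𝓝 (c m)) := by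
      refine tendsto_const_nhds.congr' ?_
      filter_upwards [eventually_gt_atTop m] with n hn
      rw [Function.comp_apply, map_sum, Finset.sum_eq_single m]
      · rw [freePairingCLM_apply, freePairing_single, hhx, mul_one]
      · intro k _ hkm
        rw [freePairingCLM_apply, freePairing_single]
        by_contra h0
        exact hkm (hdisj (x k) k m (by simp [hhx]) (right_ne_zero_of_mul h0))
      · intro hm
        exact absurd (Finset.mem_range.2 hn) hm
    rw [← freePairingCLM_apply hT]
    have : (𝓝 (freePairingCLM hT (h m) ν) ⊓ 𝓝 (c m)).NeBot := ClusterPt.mono h1 h2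
    exact eq_of_nhds_neBot this
  have hex (m : ℕ) : ∃ y ∈ ν.support, h m y ≠ 0 := by
    by_contra! h0
    refine hc m ?_
    rw [← hpair, freePairing_eq_sum]
    exact Finset.sum_eq_zero fun y hy => by rw [h0 y hy, mul_zero]
  choose y hyν hy using hex
  have hinj : Function.Injective y := fun m n hmn => hdisj (y m) m n (hy m) (hmn ▸ hy n)
  exact infinite_of_injective_forall_mem hinj hyν ν.support.finite_toSet

theorem exists_bound_seminorm_single [TopologicalSpace (FreeLSpace X 𝕜)]
    [IsTopologicalAddGroup (FreeLSpace X 𝕜)] (hT : CompatibleWithDuality X 𝕜) {A : Set X}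
    (hA : FunctionallyBounded 𝕜 A) {x : ℕ → X} (hx : ∀ n, x n ∈ A)
    {p : Seminorm 𝕜 (FreeLSpace X 𝕜)} (hp : Continuous p) :
    ∃ C : ℝ, ∀ n, p (Finsupp.single (x n) 1) ≤ C := by
  refine p.exists_bound_of_forall_dual fun φ ⟨K, hK⟩ => ?_
  have hφ : Continuous φ := by
    refine continuous_of_continuousAt_zero φ ?_
    rw [ContinuousAt, map_zero]
    refine squeeze_zero_norm hK ?_
    simpa using (hp.tendsto 0).const_mul K
  obtain ⟨f, hf⟩ := (hT φ).1 hφ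
  obtain ⟨C, hC⟩ := isBounded_iff_forall_norm_le.1 (hA f)
  refine ⟨C, fun n => ?_⟩
  rw [hf, freePairing_single, one_mul]
  exact hC _ ⟨x n, hx n, rfl⟩

variable [UniformSpace (FreeLSpace X 𝕜)] [IsUniformAddGroup (FreeLSpace X 𝕜)]
  [ContinuousSMul 𝕜 (FreeLSpace X 𝕜)] [LocallyConvexSpace ℝ (FreeLSpace X 𝕜)]

theorem cauchySeq_sum_single (hT : CompatibleWithDuality X 𝕜) {A : Set X}
    (hA : FunctionallyBounded 𝕜 A) {x : ℕ → X} (hx : ∀ n, x n ∈ A) :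
    CauchySeq fun n => ∑ k ∈ Finset.range n, Finsupp.single (x k) ((1 / 2 : 𝕜) ^ k) := by
  rw [cauchySeq_iff_tendsto, uniformity_eq_comap_nhds_zero, tendsto_comap_iff,
    (LocallyConvexSpace.polynormableSpace_of_real 𝕜 (FreeLSpace X 𝕜)).withSeminorms'.tendsto_nhds]
  rintro ⟨p, hp⟩ ε hε
  obtain ⟨C, hC⟩ := exists_bound_seminorm_single hT hA hx hp
  have hS : CauchySeq fun n => ∑ k ∈ Finset.range n, ‖(1 / 2 : 𝕜) ^ k‖ * C := by
    have : Summable fun k => ‖(1 / 2 : 𝕜) ^ k‖ * C := by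
      simpa using (summable_geometric_of_lt_one (r := (1 / 2 : ℝ)) (by norm_num)
        (by norm_num)).mul_right C
    exact this.hasSum.tendsto_sum_nat.cauchySeq
  obtain ⟨N, hN⟩ := Metric.cauchySeq_iff.1 hS ε hε
  have hle (m n : ℕ) (hmn : m ≤ n) :
      p (∑ k ∈ Finset.range n, Finsupp.single (x k) ((1 / 2 : 𝕜) ^ k) -
        ∑ k ∈ Finset.range m, Finsupp.single (x k) ((1 / 2 : 𝕜) ^ k)) ≤
      ∑ k ∈ Finset.range n, ‖(1 / 2 : 𝕜) ^ k‖ * C -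
        ∑ k ∈ Finset.range m, ‖(1 / 2 : 𝕜) ^ k‖ * C := by
    rw [← Finset.sum_Ico_eq_sub _ hmn, ← Finset.sum_Ico_eq_sub _ hmn]
    exact (Finset.le_sum_of_subadditive p (map_zero p).le (map_add_le_add p) _ _).trans
      (Finset.sum_le_sum fun k _ => seminorm_single_le (hC k) _)
  filter_upwards [eventually_ge_atTop (N, N)] with ⟨m, n⟩ hmn
  have hm : N ≤ m := hmn.1
  have hn : N ≤ n := hmn.2
  simp only [Function.comp_apply, Prod.map_apply, sub_zero]
  rcases le_total m n with hle' | hle'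
  · exact (hle m n hle').trans_lt ((le_abs_self _).trans_lt (hN n hn m hm))
  · rw [map_sub_rev]
    exact (hle n m hle').trans_lt ((le_abs_self _).trans_lt (hN m hm n hn))

theorem no_infinite_functionallyBounded_of_isSequentiallyComplete [T35Space X]
    (hT : CompatibleWithDuality X 𝕜) (hE : IsSequentiallyComplete (FreeLSpace X 𝕜)) :
    ¬ ∃ A : Set X, A.Infinite ∧ FunctionallyBounded 𝕜 A := by
  rintro ⟨A, hA, hAb⟩
  obtain ⟨x, h, hxA, hhx, hdisj⟩ := exists_seq_disjoint_bumps 𝕜 hA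
  obtain ⟨ν, hν⟩ := hE _ (cauchySeq_sum_single hT hAb hxA)
  exact not_mapClusterPt_sum_single hT hhx hdisj (by simp) ν hν.mapClusterPt

/-- The partial sums of `∑ 2⁻ᵏ⁻¹ y k` lie in every convex set containing `0` and all `y k`. -/
theorem Convex.sum_pow_smul_mem {E : Type*} [AddCommGroup E] [Module ℝ E] {K : Set E}
    (hK : Convex ℝ K) (h0 : 0 ∈ K) (n : ℕ) {y : ℕ → E} (hy : ∀ k, y k ∈ K) :
    ∑ k ∈ Finset.range n, (1 / 2 : ℝ) ^ (k + 1) • y k ∈ K := by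
  induction n generalizing y with
  | zero => simpa using h0
  | succ n ih =>
    have := hK (hy 0) (ih fun k => hy (k + 1)) (a := 1 / 2) (b := 1 / 2) (by norm_num)
      (by norm_num) (by norm_num)
    rw [Finset.sum_range_succ']
    convert this using 1
    rw [Finset.smul_sum, add_comm]
    simp only [smul_smul, zero_add, pow_one, pow_succ' (1 / 2 : ℝ) (_ + 1)]

open scoped ComplexOrder in
theorem no_infinite_functionallyBounded_of_isLocallyCompleteSpace [T35Space X]
    (hT : CompatibleWithDuality X 𝕜) (hE : IsLocallyCompleteSpace 𝕜 (FreeLSpace X 𝕜)) :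
    ¬ ∃ A : Set X, A.Infinite ∧ FunctionallyBounded 𝕜 A := by
  rintro ⟨A, hA, hAb⟩
  obtain ⟨x, h, hxA, hhx, hdisj⟩ := exists_seq_disjoint_bumps 𝕜 hA
  let y : ℕ → FreeLSpace X 𝕜 := fun k => Finsupp.single (x k) ((1 / 2 : 𝕜) ^ k)
  have hy : Tendsto y atTop (𝓝 0) := by
    rw [(LocallyConvexSpace.polynormableSpace_of_real 𝕜
      (FreeLSpace X 𝕜)).withSeminorms'.tendsto_nhds]
    rintro ⟨p, hp⟩ ε hε
    obtain ⟨C, hC⟩ := exists_bound_seminorm_single hT hAb hxA hp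
    have hlim : Tendsto (fun k => ‖(1 / 2 : 𝕜) ^ k‖ * C) atTop (𝓝 0) := by
      simpa using (tendsto_pow_atTop_nhds_zero_of_lt_one (r := (1 / 2 : ℝ)) (by norm_num)
        (by norm_num)).mul_const C
    filter_upwards [hlim.eventually_lt_const hε] with k hk
    rw [sub_zero]
    exact (seminorm_single_le (hC k) _).trans_lt hk
  have hK := hE y hy
  have hKc : Convex ℝ (closedAbsConvexHull 𝕜 (range y)) := absConvex_convexClosedHull.2.lift ℝ
  have hyK (k : ℕ) : y k ∈ closedAbsConvexHull 𝕜 (range y) :=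
    subset_closedAbsConvexHull (mem_range_self k)
  have h0 : 0 ∈ closedAbsConvexHull 𝕜 (range y) :=
    absConvex_convexClosedHull.1.zero_mem ⟨_, hyK 0⟩
  obtain ⟨ν, -, hν⟩ := hK.exists_mapClusterPt (f := atTop)
    (u := fun n => ∑ k ∈ Finset.range n, (1 / 2 : ℝ) ^ (k + 1) • y k)
    (le_principal_iff.2 (mem_map.2 (Eventually.of_forall fun n => hKc.sum_pow_smul_mem h0 n hyK)))
  refine not_mapClusterPt_sum_single hT hhx hdisj
    (c := fun k => (1 / 2 : ℝ) ^ (k + 1) • (1 / 2 : 𝕜) ^ k) (fun k => by simp) ν ?_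
  simpa only [y, Finsupp.smul_single] using hν

end Completeness

/-! ### The equivalences -/

theorem theoremt {𝕜 : Type*} [RCLike 𝕜] {X : Type*} [TopologicalSpace X] [T35Space X]
    (p : ℝ≥0∞) (hp : 1 ≤ p)
    [UniformSpace (FreeLSpace X 𝕜)] [IsUniformAddGroup (FreeLSpace X 𝕜)]
    [ContinuousSMul 𝕜 (FreeLSpace X 𝕜)] [LocallyConvexSpace ℝ (FreeLSpace X 𝕜)]
    (hT : CompatibleWithDuality X 𝕜) :
    (∀ B : Set (Cp X 𝕜), IsPrecompactSet B ↔ Bornology.IsVonNBounded 𝕜 B) ∧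
    List.TFAE [
      IsPBarrelled 𝕜 (Cp X 𝕜) p,
      ∀ B : Set (Cp X 𝕜), B.Nonempty → IsPrecompactSet B → IsPQLimited 𝕜 p ∞ B,
      ∀ B : Set (Cp X 𝕜), B.Nonempty → Bornology.IsVonNBounded 𝕜 B → IsPQLimited 𝕜 p ∞ B,
      ¬ ∃ A : Set X, A.Infinite ∧ FunctionallyBounded 𝕜 A,
      ∀ B : Set (Cp X 𝕜), B.Nonempty → Bornology.IsVonNBounded 𝕜 B →
        ∃ q, p ≤ q ∧ IsPQLimited 𝕜 p q B,
      ∃ q, p ≤ q ∧ ∀ B : Set (Cp X 𝕜), B.Nonempty → Bornology.IsVonNBounded 𝕜 B →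
        IsPQLimited 𝕜 p q B,
      ∀ q, p ≤ q → ∀ B : Set (Cp X 𝕜), B.Nonempty → Bornology.IsVonNBounded 𝕜 B →
        IsPQLimited 𝕜 p q B,
      QuasiCompleteSpace 𝕜 (FreeLSpace X 𝕜),
      IsSequentiallyComplete (FreeLSpace X 𝕜),
      IsLocallyCompleteSpace 𝕜 (FreeLSpace X 𝕜)] := by
  refine ⟨fun B => Cp.isPrecompactSet_iff_isVonNBounded, ?_⟩
  tfae_have 1 → 3 := fun h B hne hB =>
    h.isPQLimited_top hp hne (Cp.isPrecompactSet_iff_isVonNBounded.2 hB) hB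
  tfae_have 2 ↔ 3 := by simp only [Cp.isPrecompactSet_iff_isVonNBounded]
  tfae_have 3 → 4 := no_infinite_functionallyBounded_of_isPQLimited_top hp
  tfae_have 4 → 1 := fun h => isPBarrelled_of_no_infinite_functionallyBounded h hp
  tfae_have 4 → 7 := fun h q hpq B hne hB =>
    isPQLimited_of_no_infinite_functionallyBounded h hp hpq hne hB
  tfae_have 7 → 6 := fun h => ⟨p, le_rfl, h p le_rfl⟩
  tfae_have 6 → 5 := fun ⟨q, hpq, h⟩ B hne hB => ⟨q, hpq, h B hne hB⟩
  tfae_have 5 → 3 := fun h B hne hB => by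
    obtain ⟨q, hpq, hq⟩ := h B hne hB
    exact hq.mono_exponent (hp.trans hpq) le_top
  tfae_have 4 → 8 := quasiCompleteSpace_of_no_infinite_functionallyBounded hT
  tfae_have 8 → 9 := QuasiCompleteSpace.isSequentiallyComplete
  tfae_have 9 → 4 := no_infinite_functionallyBounded_of_isSequentiallyComplete hT
  tfae_have 4 → 10 := isLocallyCompleteSpace_of_no_infinite_functionallyBounded hT
  tfae_have 10 → 4 := no_infinite_functionallyBounded_of_isLocallyCompleteSpace hT
  tfae_finish
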